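/- Let $d$ be a nonnegative integer and let $\mathcal{P} \subset \mathbb{R}^d$ be a convex body (a nonempty compact convex set) in John's position, meaning that the maximum volume ellipsoid contained in $\mathcal{P}$ is the closed Euclidean unit ball $B_2 = \{x \in \mathbb{R}^d : \|x\|_2 \le 1\}$ centered at $0$ (in particular, $\mathcal{P}$ has nonempty interior). Here an ellipsoid is a set $\{c + A u : u \in B_2\}$ with $c \in \mathbb{R}^d$ and $A \in \mathbb{R}^{d \times d}$ invertible. Let $M \in \mathbb{R}^{d \times d}$ and $a \in \mathbb{R}^d$ be such that $\phi(p) = Mp + a$ is an affine endomorphism of $\mathcal{P}$, that is, $\phi(p) \in \mathcal{P}$ for every $p \in \mathcal{P}$. Then the Frobenius norm of $M$ satisfies $$\|M\|_F \le \sqrt{d + \|a\|_2^2}.$$ Moreover, if $\mathcal{P}$ is centrally symmetric (that is, $\mathcal{P} = -\mathcal{P}$), then $\|a\|_2 \le \sqrt{d}$ and $\|M\|_F \le \sqrt{2d}$. -/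

import Mathlib

open scoped Matrix.Norms.Frobenius

/-- An ellipsoid in `ℝ^d`: the image `{c + A u : ‖u‖ ≤ 1}` of the closed Euclidean unit ball
under an invertible affine map. -/
def IsEllipsoid {d : ℕ} (E : Set (EuclideanSpace ℝ (Fin d))) : Prop :=
  ∃ (A : EuclideanSpace ℝ (Fin d) ≃ₗ[ℝ] EuclideanSpace ℝ (Fin d))
    (c : EuclideanSpace ℝ (Fin d)),
    E = (fun u => c + A u) '' Metric.closedBall 0 1

/-- `E` is a maximum volume ellipsoid contained in `P`. Uniqueness of the maximizer is a theorem
about convex bodies and is not part of the definition. -/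
structure IsMaxVolumeEllipsoid {d : ℕ} (P E : Set (EuclideanSpace ℝ (Fin d))) : Prop where
  isEllipsoid : IsEllipsoid E
  subset : E ⊆ P
  volume_le : ∀ E' : Set (EuclideanSpace ℝ (Fin d)), IsEllipsoid E' → E' ⊆ P →
    MeasureTheory.volume E' ≤ MeasureTheory.volume E

/-- `P` is in John's position: the maximum volume ellipsoid contained in `P` is the Euclidean
unit ball centered at `0`. In particular such a `P` has nonempty interior. -/
def InJohnPosition {d : ℕ} (P : ConvexBody (EuclideanSpace ℝ (Fin d))) : Prop :=
  IsMaxVolumeEllipsoid (P : Set (EuclideanSpace ℝ (Fin d))) (Metric.closedBall 0 1)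

/-- `P` is centrally symmetric (about the origin): `P = -P`. -/
def IsCentrallySymmetric {d : ℕ} (P : ConvexBody (EuclideanSpace ℝ (Fin d))) : Prop :=
  ∀ p ∈ P, -p ∈ P

/-- The affine map `p ↦ M p + a` on `ℝ^d`. -/
noncomputable def affineFun {d : ℕ} (M : Matrix (Fin d) (Fin d) ℝ)
    (a : EuclideanSpace ℝ (Fin d)) (p : EuclideanSpace ℝ (Fin d)) : EuclideanSpace ℝ (Fin d) :=
  Matrix.toEuclideanLin M p + a

/-- `φ` is an endomorphism of `P`: `φ(P) ⊆ P`. -/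
def IsEndomorphism {d : ℕ} (P : ConvexBody (EuclideanSpace ℝ (Fin d)))
    (φ : EuclideanSpace ℝ (Fin d) → EuclideanSpace ℝ (Fin d)) : Prop :=
  Set.MapsTo φ (P : Set (EuclideanSpace ℝ (Fin d))) (P : Set (EuclideanSpace ℝ (Fin d)))

/-! Maximality of the unit ball is used to first order: if an infinitesimal motion `u ↦ h + H u`
points nowhere outwards at the contact directions, it cannot increase volume, so `tr H ≤ 0`
(`trace_nonpos`). This replaces John's decomposition of the identity. At a contact direction `u`,
the endomorphism gives `‖Mᵀu‖ ≤ 1 - ⟪a, u⟫`; squaring makes `H = M Mᵀ - 1 - a aᵀ`, `h = 2a`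
admissible, and its trace is `‖M‖² - d - ‖a‖²`. In the symmetric case `a = φ(0) ∈ P` gives `⟪a, u⟫²
≤ 1`, so `H = a aᵀ - 1`, `h = 0` is admissible. -/

open Filter Topology in
lemma Matrix.eventually_one_lt_det_one_add_smul {n : Type*} [Fintype n] [DecidableEq n]
    {H : Matrix n n ℝ} (hH : 0 < H.trace) : ∀ᶠ t : ℝ in 𝓝[>] 0, 1 < (1 + t • H).det := by
  -- The second-order remainder: `det (1 + t H) = 1 + t tr H + t² q(t)`.
  set q := (1 + (Polynomial.X : Polynomial ℝ) • H.map Polynomial.C).det.divX.divX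
  have hc : Tendsto (fun t : ℝ => H.trace + q.eval t * t) (𝓝[>] 0) (𝓝 H.trace) := by
    have h : Continuous fun t : ℝ => H.trace + q.eval t * t := by fun_prop
    simpa using (h.tendsto 0).mono_left nhdsWithin_le_nhds
  filter_upwards [hc.eventually_const_lt hH, self_mem_nhdsWithin] with t ht ht0
  rw [Matrix.det_one_add_smul]
  nlinarith [mul_pos (Set.mem_Ioi.1 ht0) ht]

lemma ConvexBody.exists_unit_separating {E : Type*} [NormedAddCommGroup E]
    [InnerProductSpace ℝ E] [CompleteSpace E] (P : ConvexBody E) {x : E} (hx : x ∉ P) :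
    ∃ u : E, ‖u‖ = 1 ∧ ∀ p ∈ P, inner ℝ p u < inner ℝ x u := by
  obtain ⟨f, s, hfs, hs⟩ := geometric_hahn_banach_closed_point P.convex P.isCompact.isClosed hx
  set w := (InnerProductSpace.toDual ℝ E).symm f
  have hw : ∀ y, inner ℝ y w = f y := fun y => by
    rw [real_inner_comm]; exact InnerProductSpace.toDual_symm_apply
  have key : ∀ p ∈ P, inner ℝ p w < inner ℝ x w := fun p hp => by
    rw [hw, hw]; exact (hfs p hp).trans hs
  have hw0 : w ≠ 0 := by
    intro h
    obtain ⟨p, hp⟩ := P.nonempty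
    simpa [h] using key p hp
  refine ⟨‖w‖⁻¹ • w, norm_smul_inv_norm hw0, fun p hp => ?_⟩
  rw [inner_smul_right, inner_smul_right]
  exact mul_lt_mul_of_pos_left (key p hp) (inv_pos.2 (norm_pos_iff.2 hw0))

/-- `u` is a contact direction of `P`: a unit vector whose hyperplane `⟪x, u⟫ = 1` bounds `P`. -/
def IsContactDirection {d : ℕ} (P : ConvexBody (EuclideanSpace ℝ (Fin d)))
    (u : EuclideanSpace ℝ (Fin d)) : Prop :=
  ‖u‖ = 1 ∧ ∀ p ∈ P, inner ℝ p u ≤ 1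

namespace InJohnPosition

variable {d : ℕ} {P : ConvexBody (EuclideanSpace ℝ (Fin d))}

lemma mem_of_norm_le_one (hP : InJohnPosition P) {v : EuclideanSpace ℝ (Fin d)}
    (hv : ‖v‖ ≤ 1) : v ∈ P :=
  hP.subset (by simpa using hv)

/-- Otherwise the image of the ball is an ellipsoid in `P` with `det M` times the ball's volume. -/
lemma exists_notMem_of_one_lt_det (hP : InJohnPosition P) {M : Matrix (Fin d) (Fin d) ℝ}
    (hM : 1 < M.det) (c : EuclideanSpace ℝ (Fin d)) :
    ∃ v : EuclideanSpace ℝ (Fin d), ‖v‖ ≤ 1 ∧ c + Matrix.toEuclideanLin M v ∉ P := by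
  by_contra! hsub
  have hdet : LinearMap.det (Matrix.toEuclideanLin M) = M.det := LinearMap.det_toLpLin 2 M
  have hne : LinearMap.det (Matrix.toEuclideanLin M) ≠ 0 := by rw [hdet]; linarith
  have hvol := hP.volume_le
    ((fun u => c + Matrix.toEuclideanLin M u) '' Metric.closedBall 0 1)
    ⟨LinearMap.equivOfDetNeZero _ hne, c, rfl⟩ (by
      rintro _ ⟨v, hv, rfl⟩
      exact hsub v (by simpa using hv))
  rw [← Set.image_image (fun x => c + x) (fun u => Matrix.toEuclideanLin M u),
    Set.image_add_left, MeasureTheory.measure_preimage_add,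
    MeasureTheory.Measure.addHaar_image_linearMap, hdet] at hvol
  refine hvol.not_gt ?_
  have hpos : MeasureTheory.volume (Metric.closedBall (0 : EuclideanSpace ℝ (Fin d)) 1) ≠ 0 :=
    (Metric.measure_closedBall_pos _ _ one_pos).ne'
  calc _ = 1 * MeasureTheory.volume (Metric.closedBall (0 : EuclideanSpace ℝ (Fin d)) 1) :=
        (one_mul _).symm
    _ < _ := by
      refine ENNReal.mul_lt_mul_left hpos MeasureTheory.measure_closedBall_lt_top.ne ?_
      rw [ENNReal.one_lt_ofReal]
      exact hM.trans_le (le_abs_self _)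

open Filter Topology in
/-- A first-order perturbation of the unit ball that increases volume cannot point strictly
inwards at every contact direction. -/
lemma exists_contact_nonneg (hP : InJohnPosition P) {H : Matrix (Fin d) (Fin d) ℝ}
    (hH : 0 < H.trace) (h : EuclideanSpace ℝ (Fin d)) :
    ∃ u, IsContactDirection P u ∧ 0 ≤ inner ℝ (h + Matrix.toEuclideanLin H u) u := by
  have hlim : Tendsto (fun n : ℕ => 1 / ((n : ℝ) + 1)) atTop (𝓝[>] 0) :=
    tendsto_nhdsWithin_iff.2 ⟨tendsto_one_div_add_atTop_nhds_zero_nat,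
      Eventually.of_forall fun n => by simp only [Set.mem_Ioi]; positivity⟩
  obtain ⟨N, hN⟩ := eventually_atTop.1
    (hlim.eventually (Matrix.eventually_one_lt_det_one_add_smul hH))
  obtain ⟨t, ht0, htlim, htdet⟩ : ∃ t : ℕ → ℝ, (∀ n, 0 < t n) ∧ Tendsto t atTop (𝓝 0) ∧
      ∀ n, 1 < (1 + t n • H).det :=
    ⟨fun n => 1 / (((n + N : ℕ) : ℝ) + 1), fun n => by positivity,
      (tendsto_add_atTop_iff_nat N).2 (hlim.mono_right nhdsWithin_le_nhds),
      fun n => hN _ (Nat.le_add_left _ _)⟩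
  choose v hv hvP using fun n => hP.exists_notMem_of_one_lt_det (htdet n) (t n • h)
  choose u hu hsep using fun n => P.exists_unit_separating (hvP n)
  have hx : ∀ n, t n • h + Matrix.toEuclideanLin (1 + t n • H) (v n) =
      v n + t n • (h + Matrix.toEuclideanLin H (v n)) := fun n => by
    have h1 : Matrix.toEuclideanLin (1 : Matrix (Fin d) (Fin d) ℝ) = LinearMap.id :=
      Matrix.toLpLin_one 2
    rw [map_add, map_smul, h1]
    simp only [LinearMap.add_apply, LinearMap.id_apply, LinearMap.smul_apply]
    module
  simp only [hx] at hsep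
  obtain ⟨⟨v₀, u₀⟩, ⟨hv₀, hu₀⟩, φ, hφ, hφlim⟩ :=
    ((isCompact_closedBall (0 : EuclideanSpace ℝ (Fin d)) 1).prod
      (isCompact_sphere (0 : EuclideanSpace ℝ (Fin d)) 1)).tendsto_subseq
      (x := fun n => (v n, u n)) (fun n => ⟨by simpa using hv n, by simpa using hu n⟩)
  have hvlim : Tendsto (fun n => v (φ n)) atTop (𝓝 v₀) :=
    (continuous_fst.tendsto _).comp hφlim
  have hulim : Tendsto (fun n => u (φ n)) atTop (𝓝 u₀) :=
    (continuous_snd.tendsto _).comp hφlim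
  have htφ : Tendsto (fun n => t (φ n)) atTop (𝓝 0) := htlim.comp hφ.tendsto_atTop
  have hv₀' : ‖v₀‖ ≤ 1 := by simpa using hv₀
  have hu₀' : ‖u₀‖ = 1 := by simpa using hu₀
  have hHc : Continuous (Matrix.toEuclideanLin H) := LinearMap.continuous_of_finiteDimensional _
  have hHlim : Tendsto (fun n => h + Matrix.toEuclideanLin H (v (φ n))) atTop
      (𝓝 (h + Matrix.toEuclideanLin H v₀)) :=
    tendsto_const_nhds.add ((hHc.tendsto _).comp hvlim)
  have hle : ∀ p ∈ P, inner ℝ p u₀ ≤ inner ℝ v₀ u₀ := fun p hp => by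
    have hr := (hvlim.add (htφ.smul hHlim)).inner (𝕜 := ℝ) hulim
    rw [zero_smul, add_zero] at hr
    exact le_of_tendsto_of_tendsto' (tendsto_const_nhds.inner hulim) hr
      fun n => (hsep (φ n) p hp).le
  -- Testing `hle` at `u₀`, which lies in the ball, gives `1 ≤ ⟪v₀, u₀⟫`: the equality case of
  -- Cauchy–Schwarz.
  have hvu : v₀ = u₀ := by
    have h1 := hle u₀ (hP.mem_of_norm_le_one hu₀'.le)
    rw [real_inner_self_eq_norm_sq, hu₀'] at h1
    have h2 := norm_sub_sq_real v₀ u₀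
    have h3 : ‖v₀ - u₀‖ = 0 := by
      rw [hu₀'] at h2
      nlinarith [norm_nonneg (v₀ - u₀), norm_nonneg v₀]
    exact sub_eq_zero.1 (norm_eq_zero.1 h3)
  subst hvu
  refine ⟨v₀, ⟨hu₀', fun p hp => (hle p hp).trans ?_⟩, ?_⟩
  · rw [real_inner_self_eq_norm_sq, hu₀', one_pow]
  · refine ge_of_tendsto' (hHlim.inner hulim) fun n => ?_
    -- Separating from the unperturbed point `v (φ n)` of `P` leaves only the first-order term,
    -- which is therefore positive.
    have h1 := hsep (φ n) (v (φ n)) (hP.mem_of_norm_le_one (hv _))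
    rw [inner_add_left, inner_smul_left] at h1
    exact (pos_of_mul_pos_right (by simpa using h1) (ht0 (φ n)).le).le

/-- The variational form of John's theorem. -/
lemma trace_nonpos (hP : InJohnPosition P) {H : Matrix (Fin d) (Fin d) ℝ}
    {h : EuclideanSpace ℝ (Fin d)}
    (hc : ∀ u, IsContactDirection P u → inner ℝ (h + Matrix.toEuclideanLin H u) u ≤ 0) :
    H.trace ≤ 0 := by
  by_contra! hH
  -- Subtracting `δ • 1` makes the motion strictly inward while keeping the trace positive; dividing
  -- by `d + 1` also covers `d = 0`.
  obtain ⟨δ, hδ, hδH⟩ : ∃ δ : ℝ, 0 < δ ∧ 0 < (H - δ • (1 : Matrix (Fin d) (Fin d) ℝ)).trace := by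
    refine ⟨H.trace / (d + 1), by positivity, ?_⟩
    have : H.trace / (d + 1) * d < H.trace := by
      rw [div_mul_eq_mul_div, div_lt_iff₀ (by positivity)]
      nlinarith
    simpa [Matrix.trace_sub, Matrix.trace_smul, Matrix.trace_one] using this
  obtain ⟨u, hu, hnonneg⟩ := hP.exists_contact_nonneg hδH h
  have h1 : Matrix.toEuclideanLin (1 : Matrix (Fin d) (Fin d) ℝ) = LinearMap.id :=
    Matrix.toLpLin_one 2
  have h2 : h + Matrix.toEuclideanLin (H - δ • (1 : Matrix (Fin d) (Fin d) ℝ)) u =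
      (h + Matrix.toEuclideanLin H u) - δ • u := by
    rw [map_sub, map_smul, h1, LinearMap.sub_apply, LinearMap.smul_apply, LinearMap.id_apply,
      add_sub_assoc]
  rw [h2, inner_sub_left, real_inner_smul_left, real_inner_self_eq_norm_sq, hu.1] at hnonneg
  linarith [hc u hu]

end InJohnPosition

lemma Matrix.frobenius_norm_sq {m n : Type*} [Fintype m] [Fintype n] (M : Matrix m n ℝ) :
    ‖M‖ ^ 2 = (M * M.transpose).trace := by
  rw [Matrix.frobenius_norm_def, ← Real.sqrt_eq_rpow, Real.sq_sqrt (by positivity)]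
  simp [Matrix.trace, Matrix.mul_apply, sq]

lemma Matrix.inner_toEuclideanLin_mul_transpose {n : Type*} [Fintype n] [DecidableEq n]
    (M : Matrix n n ℝ) (u : EuclideanSpace ℝ n) :
    inner ℝ (Matrix.toEuclideanLin (M * M.transpose) u) u =
      ‖Matrix.toEuclideanLin M.transpose u‖ ^ 2 := by
  have h1 : Matrix.toEuclideanLin M.transpose = LinearMap.adjoint (Matrix.toEuclideanLin M) := by
    rw [← Matrix.toEuclideanLin_conjTranspose_eq_adjoint, Matrix.conjTranspose_eq_transpose_of_trivial]
  have h2 : Matrix.toEuclideanLin (M * M.transpose) u =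
      Matrix.toEuclideanLin M (Matrix.toEuclideanLin M.transpose u) := by
    ext i; simp [Matrix.toLpLin_apply, Matrix.mulVec_mulVec]
  rw [h2, ← LinearMap.adjoint_inner_right, ← h1, real_inner_self_eq_norm_sq]

lemma Matrix.toEuclideanLin_vecMulVec_apply {n : Type*} [Fintype n] [DecidableEq n]
    (a u : EuclideanSpace ℝ n) :
    Matrix.toEuclideanLin (Matrix.vecMulVec a a) u = inner ℝ a u • a := by
  ext i
  simp [Matrix.toLpLin_apply, Matrix.vecMulVec_mulVec, PiLp.inner_apply, dotProduct, mul_comm]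

lemma Matrix.trace_vecMulVec_self {n : Type*} [Fintype n] (a : EuclideanSpace ℝ n) :
    (Matrix.vecMulVec a a).trace = ‖a‖ ^ 2 := by
  rw [Matrix.trace_vecMulVec, EuclideanSpace.real_norm_sq_eq]
  simp [dotProduct, sq]

/-- The image of the unit ball stays in the half-space `⟪x, u⟫ ≤ 1`, and `⟪M v, u⟫` has maximum
`‖Mᵀu‖` over that ball. -/
lemma IsEndomorphism.norm_transpose_add_inner_le {d : ℕ}
    {P : ConvexBody (EuclideanSpace ℝ (Fin d))} (hP : InJohnPosition P)
    {M : Matrix (Fin d) (Fin d) ℝ} {a : EuclideanSpace ℝ (Fin d)}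
    (hφ : IsEndomorphism P (affineFun M a)) {u : EuclideanSpace ℝ (Fin d)}
    (hu : IsContactDirection P u) :
    ‖Matrix.toEuclideanLin M.transpose u‖ + inner ℝ a u ≤ 1 := by
  have h1 : Matrix.toEuclideanLin M.transpose = LinearMap.adjoint (Matrix.toEuclideanLin M) := by
    rw [← Matrix.toEuclideanLin_conjTranspose_eq_adjoint, Matrix.conjTranspose_eq_transpose_of_trivial]
  set w := Matrix.toEuclideanLin M.transpose u with hw
  -- The maximizer; for `w = 0` it is `0`, which still serves.
  have hv : ‖‖w‖⁻¹ • w‖ ≤ 1 := by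
    rw [norm_smul, norm_inv, norm_norm]
    exact inv_mul_le_one
  have h2 := hu.2 _ (hφ (hP.mem_of_norm_le_one hv))
  have h3 : inner ℝ (Matrix.toEuclideanLin M (‖w‖⁻¹ • w)) u = ‖w‖ := by
    rw [← LinearMap.adjoint_inner_right, ← h1, ← hw, real_inner_smul_left,
      real_inner_self_eq_norm_sq]
    rcases eq_or_ne ‖w‖ 0 with h | h
    · simp [h]
    · field_simp
  rwa [affineFun, inner_add_left, h3] at h2

lemma IsEndomorphism.frobenius_norm_sq_le {d : ℕ}
    {P : ConvexBody (EuclideanSpace ℝ (Fin d))} (hP : InJohnPosition P)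
    {M : Matrix (Fin d) (Fin d) ℝ} {a : EuclideanSpace ℝ (Fin d)}
    (hφ : IsEndomorphism P (affineFun M a)) : ‖M‖ ^ 2 ≤ d + ‖a‖ ^ 2 := by
  have h1 : Matrix.toEuclideanLin (1 : Matrix (Fin d) (Fin d) ℝ) = LinearMap.id :=
    Matrix.toLpLin_one 2
  have key := hP.trace_nonpos (H := M * M.transpose - 1 - Matrix.vecMulVec a a)
    (h := (2 : ℝ) • a) fun u hu => by
      have h2 := hφ.norm_transpose_add_inner_le hP hu
      rw [map_sub, map_sub, h1, LinearMap.sub_apply, LinearMap.sub_apply, LinearMap.id_apply,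
        Matrix.toEuclideanLin_vecMulVec_apply, inner_add_left, inner_sub_left, inner_sub_left,
        Matrix.inner_toEuclideanLin_mul_transpose, real_inner_smul_left, real_inner_smul_left,
        real_inner_self_eq_norm_sq, hu.1]
      nlinarith [norm_nonneg (Matrix.toEuclideanLin M.transpose u)]
  rw [Matrix.trace_sub, Matrix.trace_sub, Matrix.trace_vecMulVec_self,
    ← Matrix.frobenius_norm_sq, Matrix.trace_one, Fintype.card_fin] at key
  linarith

lemma InJohnPosition.norm_sq_le_of_isCentrallySymmetric {d : ℕ}
    {P : ConvexBody (EuclideanSpace ℝ (Fin d))} (hP : InJohnPosition P)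
    (hsymm : IsCentrallySymmetric P) {a : EuclideanSpace ℝ (Fin d)} (ha : a ∈ P) :
    ‖a‖ ^ 2 ≤ d := by
  have h1 : Matrix.toEuclideanLin (1 : Matrix (Fin d) (Fin d) ℝ) = LinearMap.id :=
    Matrix.toLpLin_one 2
  have key := hP.trace_nonpos (H := Matrix.vecMulVec a a - 1) (h := 0) fun u hu => by
    have h2 := hu.2 a ha
    have h3 := hu.2 (-a) (hsymm a ha)
    rw [inner_neg_left] at h3
    rw [zero_add, map_sub, h1, LinearMap.sub_apply, LinearMap.id_apply,
      Matrix.toEuclideanLin_vecMulVec_apply, inner_sub_left, real_inner_smul_left,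
      real_inner_self_eq_norm_sq, hu.1]
    nlinarith
  rw [Matrix.trace_sub, Matrix.trace_vecMulVec_self, Matrix.trace_one, Fintype.card_fin] at key
  linarith

/-- The norm `‖M‖` of the matrix `M` is the Frobenius norm; `‖a‖` is the Euclidean norm. -/
theorem mainTheorem8 (d : ℕ) (P : ConvexBody (EuclideanSpace ℝ (Fin d)))
    (hP : InJohnPosition P) (M : Matrix (Fin d) (Fin d) ℝ) (a : EuclideanSpace ℝ (Fin d))
    (hφ : IsEndomorphism P (affineFun M a)) :
    ‖M‖ ≤ Real.sqrt ((d : ℝ) + ‖a‖ ^ 2) ∧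
      (IsCentrallySymmetric P →
        ‖a‖ ≤ Real.sqrt (d : ℝ) ∧ ‖M‖ ≤ Real.sqrt (2 * (d : ℝ))) := by
  have hM := hφ.frobenius_norm_sq_le hP
  refine ⟨Real.le_sqrt_of_sq_le hM, fun hsymm => ?_⟩
  have ha : a ∈ P := by
    have h0 := hφ (hP.mem_of_norm_le_one (v := 0) (by simp))
    rwa [affineFun, map_zero, zero_add] at h0
  have had := hP.norm_sq_le_of_isCentrallySymmetric hsymm ha
  exact ⟨Real.le_sqrt_of_sq_le had, Real.le_sqrt_of_sq_le (by linarith)⟩
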